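/- Let $n,m\ge 1$. The planar surface$(n,m)$ code has as qubits the edges of a lattice with $m$ rows of $n$ horizontal edges $h_{r,c}$ ($0\le r<m$, $0\le c<n$) and vertical edges $v_{r,c}$ ($0\le r<m-1$, $0\le c<n-1$); the vertex $(r,c)$ ($0\le r<m$, $0\le c<n-1$) lies between $h_{r,c}$ and $h_{r,c+1}$, and $v_{r,c}$ joins the vertices $(r,c)$ and $(r+1,c)$ (left and right boundaries rough, upper and lower boundaries smooth). Its $X$-stabilizer generators are the products of $X$ over the edges at a vertex, its $Z$-stabilizer generators the products of $Z$ over the edges around a face; $\overline X$ is $X$ on all $h_{r,0}$, and $\overline Z$ is $Z$ on all $h_{0,c}$. For a logical Bell measurement (BM), two copies of the code are prepared with probability $\frac14$ each in one of the four logical Bell states (joint eigenstates of $\overline X\,\overline X=(-1)^a$ and $\overline Z\,\overline Z=(-1)^b$), and every pair of corresponding qubits is measured by a static physical BM. A $ZZ{=}1$ BM always gives the eigenvalue $(-1)^z$ of $ZZ$ on the pair, and gives the eigenvalue of $XX$ only if $z=1$; an $XX{=}1$ BM is the same with $X$ and $Z$ exchanged (no photon loss, and no advanced BM, $p_{\rm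 adv}=0$). The logical BM efficiency is the probability that the collected readings unambiguously identify the logical Bell state, i.e. can arise from only one of the four. (i) For every $n\ge1$, surface$(n,n)$ with $ZZ{=}1$ BMs on the $2n-1$ diagonal edges $h_{i,i}$, $v_{i,i}$ and $XX{=}1$ BMs elsewhere has logical BM efficiency $1-2\cdot4^{-n}$. (ii) Let $n\ge m>1$. Choose a zig-zag of rows $r_0,\dots,r_{n-1}\in\{0,\dots,m-1\}$ with $|r_{c+1}-r_c|=1$ for all $c$; such a choice exists. With $ZZ{=}1$ BMs on the $2n-1$ edges $h_{r_c,c}$ and $v_{\min(r_c,r_{c+1}),c}$ and $XX{=}1$ BMs elsewhere, surface$(n,m)$ has logical BM efficiency $1-2\cdot4^{-\max(n,m)}$, for every such zig-zag. (iii) Let $m\ge n>1$. Choose a zig-zag of columns $c_0,\dots,c_{m-1}\in\{0,\dots,n-1\}$ with $|c_{r+1}-c_r|=1$ for all $r$; such a choice exists. With $XX{=}1$ BMs on the $2m-1$ edges $h_{r,c_r}$ and $v_{r,\min(c_r,c_{r+1})}$ (a zig-zag on the dual lattice) and $ZZ{=}1$ BMs elsewhere, surface$(n,m)$ has logical BM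 efficiency $1-2\cdot4^{-\max(n,m)}$, for every such zig-zag. -/

import Mathlib

open scoped Matrix

noncomputable section

namespace LogicalBM

/-! ### Two copies of an `N`-qubit register, Pauli operators, Bell states

`E` is the finite set of physical qubits of one copy.  The additive bit convention is used for
eigenvalues: the bit `0` stands for the eigenvalue `+1`, the bit `1` for `-1`. -/

/-- Pure states of two copies of a register with qubit set `E`; `ψ (u, v)` is the amplitude of
the computational basis vector `|u⟩ ⊗ |v⟩`. -/
abbrev TwoCopyState (E : Type*) [Fintype E] : Type _ :=
  EuclideanSpace ℂ ((E → ZMod 2) × (E → ZMod 2))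

/-- The eigenvalue `(-1)^a`. -/
def sign (a : ZMod 2) : ℂ := if a = 0 then 1 else -1

section Register

variable {E : Type*} [Fintype E] [DecidableEq E]

/-- Pauli `X` on the qubits in the support `s` of copy 1 and on the support `t` of copy 2. -/
def pauliX (s t : E → ZMod 2) (ψ : TwoCopyState E) : TwoCopyState E :=
  WithLp.toLp 2 fun p => ψ (p.1 + s, p.2 + t)

/-- Pauli `Z` on the qubits in the support `s` of copy 1 and on the support `t` of copy 2. -/
def pauliZ (s t : E → ZMod 2) (ψ : TwoCopyState E) : TwoCopyState E :=
  WithLp.toLp 2 fun p => sign (s ⬝ᵥ p.1 + t ⬝ᵥ p.2) * ψ p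

/-- Amplitude at `|j⟩ ⊗ |k⟩` of the Bell state of one qubit pair with `XX = (-1)^a` and
`ZZ = (-1)^b`, namely `(|0, b⟩ + (-1)^a |1, 1 + b⟩) / √2`. -/
def bellAmplitude (a b j k : ZMod 2) : ℂ :=
  if k = j + b then sign (a * j) / (Real.sqrt 2 : ℂ) else 0

/-- The product of physical Bell states, one for every pair of corresponding qubits; the pair
at `e` has `XX`-bit `x e` and `ZZ`-bit `z e`. -/
def bellProduct (x z : E → ZMod 2) : TwoCopyState E :=
  WithLp.toLp 2 fun p => ∏ e, bellAmplitude (x e) (z e) (p.1 e) (p.2 e)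

/-! ### Transversal static linear-optical Bell measurements without loss and with `p_adv = 0` -/

/-- The two guaranteed-information Bell measurements (BMs) in use. -/
inductive PhysicalBM
  /-- `ZZ = 1` BM: always yields the `ZZ`-bit, and the `XX`-bit only if the `ZZ`-bit is `1`. -/
  | zz1
  /-- `XX = 1` BM: always yields the `XX`-bit, and the `ZZ`-bit only if the `XX`-bit is `1`. -/
  | xx1

/-- What is learnt about (`XX`-bit, `ZZ`-bit) of a qubit pair in the Bell state `(x, z)`;
`none` means that the bit is not obtained. -/
def PhysicalBM.reading : PhysicalBM → ZMod 2 → ZMod 2 → Option (ZMod 2) × Option (ZMod 2)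
  | .zz1, x, z => (if z = 1 then some x else none, some z)
  | .xx1, x, z => (some x, if x = 1 then some z else none)

/-- A measurement record: the readings at all qubit pairs. -/
abbrev Record (E : Type*) : Type _ := E → Option (ZMod 2) × Option (ZMod 2)

/-- The record that the formation `F` of physical BMs gives on a product of Bell states. -/
def record (F : E → PhysicalBM) (x z : E → ZMod 2) : Record E :=
  fun e => (F e).reading (x e) (z e)

open Classical in
/-- Born probability of the record `r` in the state `ψ`: the squared norm of the projection of
`ψ` to the span of the (orthonormal) Bell products that give the record `r`. -/
def recordProb (F : E → PhysicalBM) (ψ : TwoCopyState E) (r : Record E) : ℝ :=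
  ∑ x : E → ZMod 2, ∑ z : E → ZMod 2,
    if record F x z = r then ‖inner ℂ (bellProduct x z) ψ‖ ^ 2 else 0

/-- Among the four states `Φ a b`, only `Φ a b` itself can give the record `r`, so that `r`
identifies it unambiguously. -/
def Identifies (F : E → PhysicalBM) (Φ : ZMod 2 → ZMod 2 → TwoCopyState E) (r : Record E)
    (a b : ZMod 2) : Prop :=
  ∀ a' b', (a', b') ≠ (a, b) → recordProb F (Φ a' b') r = 0

open Classical in
/-- Probability that the record identifies the state unambiguously, when one of the four states
`Φ a b` is prepared with probability `1/4` each. -/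
def successProb (F : E → PhysicalBM) (Φ : ZMod 2 → ZMod 2 → TwoCopyState E) : ℝ :=
  (1 / 4) * ∑ a, ∑ b, ∑ r : Record E,
    if Identifies F Φ r a b then recordProb F (Φ a b) r else 0

end Register

/-! ### CSS codes and logical Bell states -/

/-- A CSS code, given by (the supports of) its `X`- and `Z`-type stabilizer generators, with a
pair of logical operators `X̄`, `Z̄`. -/
structure CSSCode (E : Type*) [Fintype E] where
  xGens : Set (E → ZMod 2)
  zGens : Set (E → ZMod 2)
  logX : E → ZMod 2
  logZ : E → ZMod 2
  gens_comm : ∀ g ∈ xGens, ∀ h ∈ zGens, g ⬝ᵥ h = 0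
  logX_comm : ∀ h ∈ zGens, logX ⬝ᵥ h = 0
  logZ_comm : ∀ g ∈ xGens, g ⬝ᵥ logZ = 0
  log_anticomm : logX ⬝ᵥ logZ = 1

/-- `ψ` is a logical Bell state of two copies of the code, with `X̄X̄ = (-1)^a` and
`Z̄Z̄ = (-1)^b`: a unit vector that is fixed by all stabilizer generators of either copy. -/
structure IsLogicalBellState {E : Type*} [Fintype E] [DecidableEq E] (C : CSSCode E)
    (a b : ZMod 2) (ψ : TwoCopyState E) : Prop where
  norm_eq_one : ‖ψ‖ = 1
  x_stab_fst : ∀ g ∈ C.xGens, pauliX g 0 ψ = ψ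
  x_stab_snd : ∀ g ∈ C.xGens, pauliX 0 g ψ = ψ
  z_stab_fst : ∀ h ∈ C.zGens, pauliZ h 0 ψ = ψ
  z_stab_snd : ∀ h ∈ C.zGens, pauliZ 0 h ψ = ψ
  logXX : pauliX C.logX C.logX ψ = sign a • ψ
  logZZ : pauliZ C.logZ C.logZ ψ = sign b • ψ

/-- The loss-free logical BM efficiency of the code `C` with the formation `F` is `p`: the four
logical Bell states exist, and for any choice of them (each is determined up to a phase) the
success probability is `p`. -/
def HasEfficiency {E : Type*} [Fintype E] [DecidableEq E] (C : CSSCode E) (F : E → PhysicalBM)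
    (p : ℝ) : Prop :=
  (∃ Φ : ZMod 2 → ZMod 2 → TwoCopyState E, ∀ a b, IsLogicalBellState C a b (Φ a b)) ∧
  ∀ Φ : ZMod 2 → ZMod 2 → TwoCopyState E,
    (∀ a b, IsLogicalBellState C a b (Φ a b)) → successProb F Φ = p

/-! ### The planar surface code

`m` rows of `n` horizontal edges, the outermost ones dangling at the (rough) left and right
boundaries; the vertices `(r, c)`, `r < m`, `c < n - 1`, lie between the horizontal edges
`(r, c)` and `(r, c + 1)`; the vertical edge `(r, c)`, `r < m - 1`, joins the vertices `(r, c)`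
and `(r + 1, c)`.  The upper and lower boundaries are smooth. -/

/-- Qubits of surface(`n`,`m`): horizontal edges (`inl`) and vertical edges (`inr`). -/
abbrev Edge (n m : ℕ) : Type := (Fin m × Fin n) ⊕ (Fin (m - 1) × Fin (n - 1))

/-- Edges at the vertex `(r, c)`: support of an `X`-stabilizer generator. -/
def vertex (n m : ℕ) (p : Fin m × Fin (n - 1)) : Edge n m → ZMod 2
  | .inl e => if e.1.val = p.1.val ∧ (e.2.val = p.2.val ∨ e.2.val = p.2.val + 1) then 1 else 0
  | .inr e => if e.2.val = p.2.val ∧ (e.1.val = p.1.val ∨ e.1.val + 1 = p.1.val) then 1 else 0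

/-- Edges around the face between the horizontal edges `(r, c)` and `(r + 1, c)`: support of a
`Z`-stabilizer generator. -/
def face (n m : ℕ) (q : Fin (m - 1) × Fin n) : Edge n m → ZMod 2
  | .inl e => if e.2.val = q.2.val ∧ (e.1.val = q.1.val ∨ e.1.val = q.1.val + 1) then 1 else 0
  | .inr e => if e.1.val = q.1.val ∧ (e.2.val = q.2.val ∨ e.2.val + 1 = q.2.val) then 1 else 0

/-- The first column of horizontal edges, of weight `m`: support of `X̄`. -/
def firstColumn (n m : ℕ) : Edge n m → ZMod 2
  | .inl e => if e.2.val = 0 then 1 else 0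
  | .inr _ => 0

/-- The first row of horizontal edges, of weight `n`: support of `Z̄`. -/
def firstRow (n m : ℕ) : Edge n m → ZMod 2
  | .inl e => if e.1.val = 0 then 1 else 0
  | .inr _ => 0

theorem vertex_dot_face (n m : ℕ) (p : Fin m × Fin (n - 1)) (q : Fin (m - 1) × Fin n) :
    vertex n m p ⬝ᵥ face n m q = 0 := by
  obtain ⟨r, c⟩ := p
  obtain ⟨i, k⟩ := q
  have h1 : ∀ e : Fin m × Fin n,
      vertex n m (r, c) (.inl e) * face n m (i, k) (.inl e) = if e = (r, k) then
        (if (r.val = i.val ∨ r.val = i.val + 1) ∧ (k.val = c.val ∨ k.val = c.val + 1)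
          then 1 else 0) else 0 := by
    rintro ⟨a, b⟩
    simp only [vertex, face, Prod.mk.injEq, Fin.ext_iff]
    split_ifs <;> first | rfl | (exfalso; omega)
  have h2 : ∀ e : Fin (m - 1) × Fin (n - 1),
      vertex n m (r, c) (.inr e) * face n m (i, k) (.inr e) = if e = (i, c) then
        (if (r.val = i.val ∨ r.val = i.val + 1) ∧ (k.val = c.val ∨ k.val = c.val + 1)
          then 1 else 0) else 0 := by
    rintro ⟨a, b⟩
    simp only [vertex, face, Prod.mk.injEq, Fin.ext_iff]
    split_ifs <;> first | rfl | (exfalso; omega)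
  rw [dotProduct, Fintype.sum_sum_type]
  simp only [h1, h2, Finset.sum_ite_eq', Finset.mem_univ, if_true]
  exact CharTwo.add_self_eq_zero _

theorem firstColumn_dot_face (n m : ℕ) (q : Fin (m - 1) × Fin n) :
    firstColumn n m ⬝ᵥ face n m q = 0 := by
  obtain ⟨i, k⟩ := q
  have hi := i.isLt
  have h1 : ∀ e : Fin m × Fin n,
      firstColumn n m (.inl e) * face n m (i, k) (.inl e) =
        (if e = (⟨i.val, by omega⟩, k) then (if k.val = 0 then 1 else 0) else 0) +
        (if e = (⟨i.val + 1, by omega⟩, k) then (if k.val = 0 then 1 else 0) else 0) := by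
    rintro ⟨a, b⟩
    simp only [firstColumn, face, Prod.mk.injEq, Fin.ext_iff]
    split_ifs <;> first | rfl | (exfalso; omega)
  rw [dotProduct, Fintype.sum_sum_type]
  simp only [h1, Finset.sum_add_distrib, Finset.sum_ite_eq', Finset.mem_univ, if_true]
  simp only [firstColumn, zero_mul, Finset.sum_const_zero, add_zero]
  exact CharTwo.add_self_eq_zero _

theorem vertex_dot_firstRow (n m : ℕ) (p : Fin m × Fin (n - 1)) :
    vertex n m p ⬝ᵥ firstRow n m = 0 := by
  obtain ⟨r, c⟩ := p
  have hc := c.isLt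
  have h1 : ∀ e : Fin m × Fin n,
      vertex n m (r, c) (.inl e) * firstRow n m (.inl e) =
        (if e = (r, ⟨c.val, by omega⟩) then (if r.val = 0 then 1 else 0) else 0) +
        (if e = (r, ⟨c.val + 1, by omega⟩) then (if r.val = 0 then 1 else 0) else 0) := by
    rintro ⟨a, b⟩
    simp only [firstRow, vertex, Prod.mk.injEq, Fin.ext_iff]
    split_ifs <;> first | rfl | (exfalso; omega)
  rw [dotProduct, Fintype.sum_sum_type]
  simp only [h1, Finset.sum_add_distrib, Finset.sum_ite_eq', Finset.mem_univ, if_true]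
  simp only [firstRow, mul_zero, Finset.sum_const_zero, add_zero]
  exact CharTwo.add_self_eq_zero _

theorem firstColumn_dot_firstRow (n m : ℕ) (hn : 0 < n) (hm : 0 < m) :
    firstColumn n m ⬝ᵥ firstRow n m = 1 := by
  have h1 : ∀ e : Fin m × Fin n,
      firstColumn n m (.inl e) * firstRow n m (.inl e) =
        if e = (⟨0, hm⟩, ⟨0, hn⟩) then 1 else 0 := by
    rintro ⟨a, b⟩
    simp only [firstColumn, firstRow, Prod.mk.injEq, Fin.ext_iff]
    split_ifs <;> first | rfl | (exfalso; omega)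
  rw [dotProduct, Fintype.sum_sum_type]
  simp only [h1, Finset.sum_ite_eq', Finset.mem_univ, if_true]
  simp [firstRow]

/-- The planar surface(`n`,`m`) code. -/
def surfaceCode (n m : ℕ) (hn : 0 < n) (hm : 0 < m) : CSSCode (Edge n m) where
  xGens := Set.range (vertex n m)
  zGens := Set.range (face n m)
  logX := firstColumn n m
  logZ := firstRow n m
  gens_comm := by
    rintro _ ⟨p, rfl⟩ _ ⟨q, rfl⟩
    exact vertex_dot_face n m p q
  logX_comm := by
    rintro _ ⟨q, rfl⟩
    exact firstColumn_dot_face n m q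
  logZ_comm := by
    rintro _ ⟨p, rfl⟩
    exact vertex_dot_firstRow n m p
  log_anticomm := firstColumn_dot_firstRow n m hn hm

/-! ### Formations -/

/-- `ZZ = 1` BMs on the `2 n - 1` edges whose midpoints lie on the diagonal of the lattice of
surface(`n`,`n`), and `XX = 1` BMs elsewhere. -/
def diagonalFormation (n : ℕ) : Edge n n → PhysicalBM
  | .inl e => if e.1.val = e.2.val then .zz1 else .xx1
  | .inr e => if e.1.val = e.2.val then .zz1 else .xx1

/-- `r 0, …, r (k - 1)` is a zig-zag of length `k` in `{0, …, l - 1}`: every step goes up or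
down by exactly one. -/
def IsZigzag (k l : ℕ) (r : ℕ → ℕ) : Prop :=
  (∀ i < k, r i < l) ∧ ∀ i, i + 1 < k → r (i + 1) = r i + 1 ∨ r i = r (i + 1) + 1

/-- `ZZ = 1` BMs on the lattice path from the left to the right boundary that passes column `c`
along the horizontal edge in row `r c` and has the vertical edge joining the rows `r c` and
`r (c + 1)` in between (`2 n - 1` edges in total); `XX = 1` BMs elsewhere. -/
def zigzagFormation (n m : ℕ) (r : ℕ → ℕ) : Edge n m → PhysicalBM
  | .inl e => if e.1.val = r e.2.val then .zz1 else .xx1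
  | .inr e => if e.1.val = min (r e.2.val) (r (e.2.val + 1)) then .zz1 else .xx1

/-- The same on the dual lattice with `XX` and `ZZ` exchanged: `XX = 1` BMs on the path of dual
edges from the upper to the lower boundary that crosses row `i` at the horizontal edge in column
`c i` and the vertical edge between the columns `c i` and `c (i + 1)` in between (`2 m - 1` edges
in total); `ZZ = 1` BMs elsewhere. -/
def dualZigzagFormation (n m : ℕ) (c : ℕ → ℕ) : Edge n m → PhysicalBM
  | .inl e => if e.2.val = c e.1.val then .xx1 else .zz1
  | .inr e => if e.2.val = min (c e.1.val) (c (e.1.val + 1)) then .xx1 else .zz1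

end LogicalBM

end

/-!
The Bell products `|x, z⟩` form an orthonormal basis, and Pauli operators act on it by signs and
shifts (`pauliX_bellProduct`, `pauliZ_bellProduct`). A stabilizer applied to both copies makes the
overlap of a logical Bell state with `|x, z⟩` vanish unless `x` is orthogonal to all
`X`-generators and `z` to all `Z`-generators, and the logical operators fix the two remaining
bits. A stabilizer applied to one copy only shifts `x` by a `Z`-stabilizer or `z` by an
`X`-stabilizer. When the code encodes exactly one qubit, these shifts are transitive on the allowed
outcomes, so that all of them are equally likely, and the efficiency is the fraction of outcomes
whose record fixes the logical bits (`CSSCode.EncodesOneQubit.hasEfficiency`).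

Let the `ZZ = 1` measurements occupy the support of a vector `p` that represents `Z̄` and contains
no smaller cycle (`CSSCode.IsMinimalPath`). All `ZZ`-bits on `p` are read, hence so is `Z̄Z̄`. Two
outcomes with the same record have `XX`-bits that differ by a cycle inside the part of `p` where
`z` vanishes; this is trivial, unless `z` vanishes on all of `p`, when adding `p` flips `X̄X̄`
unnoticed. The `ZZ`-bits on `p` are independent and uniform, because a parity check on them would
be a cycle inside `p` that commutes with `X̄`. So the failure probability is `2 ^ (-|p|)`
(`CSSCode.IsMinimalPath.unambiguousFraction_eq`).

A zig-zag is such a path, with `2 n - 1` edges (`zigzagPath_isMinimalPath`, `card_zigzagPath`), and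
the diagonal is the zig-zag `r c = c`. That the planar code encodes one qubit is the vanishing of a
homology group; a chain bounding a given cycle is found by summing down the columns
(`eq_sum_face`). The statements with `X` and `Z` exchanged follow by reflecting the lattice in its
diagonal (`transposeEdge`) and from the symmetry of the counting problem
(`CSSCode.unambiguousFraction_dual`).
-/

noncomputable section

namespace LogicalBM

/-! ### Signs and the action of Pauli operators on products of Bell states -/

theorem sign_add (a b : ZMod 2) : sign (a + b) = sign a * sign b := by
  by_cases ha : a = 0
  · simp [sign, ha]
  by_cases hb : b = 0
  · simp [sign, hb]
  have h : a + b = 0 := by revert a b; decide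
  simp [sign, ha, hb, h]

@[simp] theorem sign_zero : sign 0 = 1 := rfl

theorem sign_injective : Function.Injective sign := by
  intro a b h
  by_contra hab
  have h2 : a = 0 ∧ b = 1 ∨ a = 1 ∧ b = 0 := by
    clear h; revert a b; decide
  rcases h2 with ⟨rfl, rfl⟩ | ⟨rfl, rfl⟩ <;> norm_num [sign] at h

theorem conj_sign (a : ZMod 2) : starRingEnd ℂ (sign a) = sign a := by
  unfold sign; split_ifs <;> simp

theorem norm_sign (a : ZMod 2) : ‖sign a‖ = 1 := by
  unfold sign; split_ifs <;> simp

theorem sign_sum {ι : Type*} (s : Finset ι) (f : ι → ZMod 2) :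
    sign (∑ i ∈ s, f i) = ∏ i ∈ s, sign (f i) := by
  classical
  induction s using Finset.induction_on with
  | empty => simp
  | insert i s hi ih => rw [Finset.sum_insert hi, Finset.prod_insert hi, sign_add, ih]

theorem zmod_two_eq_one_of_ne_zero {a : ZMod 2} (h : a ≠ 0) : a = 1 := by
  revert a; decide

section Register

variable {E : Type*} [Fintype E]

@[simp] theorem pauliX_apply (s t : E → ZMod 2) (ψ : TwoCopyState E)
    (p : (E → ZMod 2) × (E → ZMod 2)) : pauliX s t ψ p = ψ (p.1 + s, p.2 + t) := rfl

@[simp] theorem pauliZ_apply (s t : E → ZMod 2) (ψ : TwoCopyState E)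
    (p : (E → ZMod 2) × (E → ZMod 2)) :
    pauliZ s t ψ p = sign (s ⬝ᵥ p.1 + t ⬝ᵥ p.2) * ψ p := rfl

@[simp] theorem bellProduct_apply (x z : E → ZMod 2) (p : (E → ZMod 2) × (E → ZMod 2)) :
    bellProduct x z p = ∏ e, bellAmplitude (x e) (z e) (p.1 e) (p.2 e) := rfl

theorem pauliX_pauliX (s t s' t' : E → ZMod 2) (ψ : TwoCopyState E) :
    pauliX s t (pauliX s' t' ψ) = pauliX (s + s') (t + t') ψ := by
  ext p; simp [add_assoc]

theorem pauliZ_pauliZ (s t s' t' : E → ZMod 2) (ψ : TwoCopyState E) :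
    pauliZ s t (pauliZ s' t' ψ) = pauliZ (s + s') (t + t') ψ := by
  ext p
  simp only [pauliZ_apply, add_dotProduct, sign_add]
  ring

/-- Pauli `X` with exponents `s`, `t` on a single pair shifts the `ZZ`-bit by `s + t`. -/
theorem bellAmplitude_shift (a b j k s t : ZMod 2) :
    bellAmplitude a b (j + s) (k + t) = sign (s * a) * bellAmplitude a (b + (s + t)) j k := by
  have h : k + t = j + s + b ↔ k = j + (b + (s + t)) := by
    revert k t j s b; decide
  simp only [bellAmplitude, h]
  split_ifs
  · rw [mul_add, sign_add, mul_comm a s]; ring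
  · simp

/-- Pauli `Z` with exponents `s`, `t` on a single pair shifts the `XX`-bit by `s + t`. -/
theorem bellAmplitude_phase (a b j k s t : ZMod 2) :
    sign (s * j + t * k) * bellAmplitude a b j k =
      sign (t * b) * bellAmplitude (a + (s + t)) b j k := by
  simp only [bellAmplitude]
  split_ifs with h
  · have : s * j + t * k + a * j = t * b + (a + (s + t)) * j := by
      rw [h]; ring
    rw [← mul_div_assoc, ← mul_div_assoc, ← sign_add, ← sign_add, this]
  · simp

/-- Up to a sign, `X` errors permute the Bell products by shifting their `ZZ`-bits. -/
theorem pauliX_bellProduct (s t x z : E → ZMod 2) :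
    pauliX s t (bellProduct x z) = sign (s ⬝ᵥ x) • bellProduct x (z + (s + t)) := by
  ext p
  simp only [pauliX_apply, bellProduct_apply, PiLp.smul_apply, smul_eq_mul, Pi.add_apply,
    bellAmplitude_shift, Finset.prod_mul_distrib, dotProduct, sign_sum]

/-- Up to a sign, `Z` errors permute the Bell products by shifting their `XX`-bits. -/
theorem pauliZ_bellProduct (s t x z : E → ZMod 2) :
    pauliZ s t (bellProduct x z) = sign (t ⬝ᵥ z) • bellProduct (x + (s + t)) z := by
  ext p
  simp only [pauliZ_apply, bellProduct_apply, PiLp.smul_apply, smul_eq_mul, Pi.add_apply,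
    dotProduct, ← Finset.sum_add_distrib, sign_sum, ← Finset.prod_mul_distrib,
    bellAmplitude_phase]

theorem pauliX_diag_bellProduct (s x z : E → ZMod 2) :
    pauliX s s (bellProduct x z) = sign (s ⬝ᵥ x) • bellProduct x z := by
  rw [pauliX_bellProduct, show s + s = 0 from funext fun e => CharTwo.add_self_eq_zero _, add_zero]

theorem pauliZ_diag_bellProduct (s x z : E → ZMod 2) :
    pauliZ s s (bellProduct x z) = sign (s ⬝ᵥ z) • bellProduct x z := by
  rw [pauliZ_bellProduct, show s + s = 0 from funext fun e => CharTwo.add_self_eq_zero _, add_zero]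

variable [DecidableEq E]

theorem inner_pauliX_left (s t : E → ZMod 2) (φ ψ : TwoCopyState E) :
    inner ℂ (pauliX s t φ) ψ = inner ℂ φ (pauliX s t ψ) := by
  simp only [PiLp.inner_apply]
  have h2 : ∀ u : E → ZMod 2, u + u = 0 := fun u => funext fun e => CharTwo.add_self_eq_zero _
  refine Fintype.sum_equiv (Equiv.addRight (s, t)) _ _ fun p => ?_
  simp [Equiv.addRight, add_assoc, h2, Prod.add_def]

theorem inner_pauliZ_left (s t : E → ZMod 2) (φ ψ : TwoCopyState E) :
    inner ℂ (pauliZ s t φ) ψ = inner ℂ φ (pauliZ s t ψ) := by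
  simp only [PiLp.inner_apply]
  refine Finset.sum_congr rfl fun p _ => ?_
  simp [conj_sign]
  ring

/-- Eigenvectors of a self-adjoint Pauli operator for distinct eigenvalues are orthogonal. -/
theorem inner_eq_zero_of_pauliX_eigen {s : E → ZMod 2} {a b : ZMod 2} {φ ψ : TwoCopyState E}
    (hφ : pauliX s s φ = sign a • φ) (hψ : pauliX s s ψ = sign b • ψ) (hab : a ≠ b) :
    inner ℂ φ ψ = 0 := by
  have h := inner_pauliX_left s s φ ψ
  rw [hφ, hψ, inner_smul_left, inner_smul_right, conj_sign] at h
  have h' : (sign a - sign b) * inner ℂ φ ψ = 0 := by rw [sub_mul, h, sub_self]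
  exact (mul_eq_zero.1 h').resolve_left (sub_ne_zero.2 fun h => hab (sign_injective h))

theorem inner_eq_zero_of_pauliZ_eigen {s : E → ZMod 2} {a b : ZMod 2} {φ ψ : TwoCopyState E}
    (hφ : pauliZ s s φ = sign a • φ) (hψ : pauliZ s s ψ = sign b • ψ) (hab : a ≠ b) :
    inner ℂ φ ψ = 0 := by
  have h := inner_pauliZ_left s s φ ψ
  rw [hφ, hψ, inner_smul_left, inner_smul_right, conj_sign] at h
  have h' : (sign a - sign b) * inner ℂ φ ψ = 0 := by rw [sub_mul, h, sub_self]
  exact (mul_eq_zero.1 h').resolve_left (sub_ne_zero.2 fun h => hab (sign_injective h))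

/-- Only the `2 ^ |E|` basis vectors `|u⟩ ⊗ |u + z⟩` have nonzero amplitude, of equal modulus. -/
theorem norm_bellProduct (x z : E → ZMod 2) : ‖bellProduct x z‖ = 1 := by
  rw [EuclideanSpace.norm_eq, Real.sqrt_eq_one, Fintype.sum_prod_type]
  have key : ∀ u v : E → ZMod 2,
      ‖bellProduct x z (u, v)‖ ^ 2 = if v = u + z then (1 / 2 : ℝ) ^ Fintype.card E else 0 := by
    intro u v
    rw [bellProduct_apply, norm_prod, ← Finset.prod_pow]
    split_ifs with h
    · subst h
      rw [← Finset.card_univ, ← Finset.prod_const]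
      refine Finset.prod_congr rfl fun e _ => ?_
      simp [bellAmplitude, norm_sign]
    · obtain ⟨e, he⟩ := Function.ne_iff.1 h
      refine Finset.prod_eq_zero (Finset.mem_univ e) ?_
      simp only [Pi.add_apply] at he
      simp [bellAmplitude, he]
  simp only [key, Finset.sum_ite_eq', Finset.mem_univ, if_true, Finset.sum_const,
    Finset.card_univ, nsmul_eq_mul, Fintype.card_fun, ZMod.card]
  rw [Nat.cast_pow, ← mul_pow]
  norm_num

theorem orthonormal_bellProduct :
    Orthonormal ℂ fun p : (E → ZMod 2) × (E → ZMod 2) => bellProduct p.1 p.2 := by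
  refine ⟨fun p => norm_bellProduct _ _, fun p q hpq => ?_⟩
  by_cases h : p.1 = q.1
  · have h2 : p.2 ≠ q.2 := fun h2 => hpq (Prod.ext h h2)
    obtain ⟨e, he⟩ := Function.ne_iff.1 h2
    refine inner_eq_zero_of_pauliZ_eigen (pauliZ_diag_bellProduct (Pi.single e 1) _ _)
      (pauliZ_diag_bellProduct _ _ _) ?_
    simpa using he
  · obtain ⟨e, he⟩ := Function.ne_iff.1 h
    refine inner_eq_zero_of_pauliX_eigen (pauliX_diag_bellProduct (Pi.single e 1) _ _)
      (pauliX_diag_bellProduct _ _ _) ?_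
    simpa using he

/-- Parseval's identity for the Bell products, which form an orthonormal basis. -/
theorem sum_norm_inner_bellProduct_sq (ψ : TwoCopyState E) :
    ∑ x : E → ZMod 2, ∑ z : E → ZMod 2, ‖inner ℂ (bellProduct x z) ψ‖ ^ 2 = ‖ψ‖ ^ 2 := by
  have hspan : ⊤ ≤ Submodule.span ℂ
      (Set.range fun p : (E → ZMod 2) × (E → ZMod 2) => bellProduct p.1 p.2) := by
    refine (LinearIndependent.span_eq_top_of_card_eq_finrank'
      orthonormal_bellProduct.linearIndependent ?_).ge
    rw [finrank_euclideanSpace]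
  have h := (OrthonormalBasis.mk orthonormal_bellProduct hspan).sum_sq_norm_inner_right ψ
  rw [← h, Fintype.sum_prod_type]
  simp

end Register

/-! ### Logical Bell states in the Bell product basis -/

/-- The vectors orthogonal to all of `G`: outcomes compatible with trivial syndromes of the
checks `G`. -/
def checkKernel {E : Type*} [Fintype E] (G : Set (E → ZMod 2)) :
    Submodule (ZMod 2) (E → ZMod 2) where
  carrier := {x | ∀ g ∈ G, g ⬝ᵥ x = 0}
  add_mem' hx hy g hg := by rw [dotProduct_add, hx g hg, hy g hg, add_zero]
  zero_mem' g _ := dotProduct_zero g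
  smul_mem' c x hx g hg := by rw [dotProduct_smul, hx g hg, smul_zero]

section Code

variable {E : Type*} [Fintype E]

theorem mem_checkKernel {G : Set (E → ZMod 2)} {x : E → ZMod 2} :
    x ∈ checkKernel G ↔ ∀ g ∈ G, g ⬝ᵥ x = 0 := Iff.rfl

theorem dotProduct_eq_zero_of_mem_span {G : Set (E → ZMod 2)} {x y : E → ZMod 2}
    (hx : x ∈ checkKernel G) (hy : y ∈ Submodule.span (ZMod 2) G) : y ⬝ᵥ x = 0 := by
  induction hy using Submodule.span_induction with
  | mem y hy => exact hx y hy
  | zero => exact zero_dotProduct x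
  | add y y' _ _ h h' => rw [add_dotProduct, h, h', add_zero]
  | smul c y _ h => rw [smul_dotProduct, h, smul_zero]

/-- The code has no logical operators besides `X̄` and `Z̄` up to stabilizers, i.e. it encodes
exactly one qubit. -/
structure CSSCode.EncodesOneQubit (C : CSSCode E) : Prop where
  mem_span_zGens : ∀ x ∈ checkKernel C.xGens, C.logX ⬝ᵥ x = 0 → x ∈ Submodule.span (ZMod 2) C.zGens
  mem_span_xGens : ∀ z ∈ checkKernel C.zGens, C.logZ ⬝ᵥ z = 0 → z ∈ Submodule.span (ZMod 2) C.xGens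

theorem CSSCode.xGens_le_checkKernel (C : CSSCode E) :
    Submodule.span (ZMod 2) C.xGens ≤ checkKernel C.zGens :=
  Submodule.span_le.2 fun g hg h hh => by rw [dotProduct_comm]; exact C.gens_comm g hg h hh

theorem CSSCode.logZ_mem_checkKernel (C : CSSCode E) : C.logZ ∈ checkKernel C.xGens :=
  C.logZ_comm

theorem CSSCode.logX_mem_checkKernel (C : CSSCode E) : C.logX ∈ checkKernel C.zGens :=
  fun h hh => by rw [dotProduct_comm]; exact C.logX_comm h hh

theorem CSSCode.logZ_dotProduct_eq_zero (C : CSSCode E) {y : E → ZMod 2}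
    (hy : y ∈ Submodule.span (ZMod 2) C.xGens) : C.logZ ⬝ᵥ y = 0 := by
  rw [dotProduct_comm]
  exact dotProduct_eq_zero_of_mem_span C.logZ_mem_checkKernel hy

/-- The outcomes `(x, z)` that can occur on the logical Bell state `(a, b)`. -/
def CSSCode.sector (C : CSSCode E) (a b : ZMod 2) : Set ((E → ZMod 2) × (E → ZMod 2)) :=
  {p | (p.1 ∈ checkKernel C.xGens ∧ C.logX ⬝ᵥ p.1 = a) ∧
    (p.2 ∈ checkKernel C.zGens ∧ C.logZ ⬝ᵥ p.2 = b)}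

/-- Shifting by `Z̄` and `X̄` matches the outcomes of any two logical Bell states. -/
theorem CSSCode.card_sector (C : CSSCode E) (a b : ZMod 2) :
    Nat.card (C.sector a b) = Nat.card (C.sector 0 0) := by
  have hlog : C.logZ ⬝ᵥ C.logX = 1 := by rw [dotProduct_comm]; exact C.log_anticomm
  refine Nat.card_congr ((Equiv.addRight (a • C.logZ, b • C.logX)).subtypeEquiv fun p => ?_).symm
  simp only [CSSCode.sector, Set.mem_ofPred_eq, Equiv.coe_addRight, Prod.fst_add, Prod.snd_add]
  rw [Submodule.add_mem_iff_left _ (Submodule.smul_mem _ _ C.logZ_mem_checkKernel),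
    Submodule.add_mem_iff_left _ (Submodule.smul_mem _ _ C.logX_mem_checkKernel)]
  simp [dotProduct_add, hlog, C.log_anticomm]

variable [DecidableEq E]

open Classical in
/-- The logical Bell states exist: the amplitude at `|u⟩ ⊗ |v⟩` is nonzero when `u` and `v`
satisfy all `Z`-checks and carry logical bits `j`, `k` with `k = j + b`; it is then
proportional to `(-1)^(a j)`. -/
theorem CSSCode.exists_isLogicalBellState (C : CSSCode E) (a b : ZMod 2) :
    ∃ ψ, IsLogicalBellState C a b ψ := by
  set φ : TwoCopyState E := WithLp.toLp 2 fun p =>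
    if p.1 ∈ checkKernel C.zGens ∧ p.2 ∈ checkKernel C.zGens ∧ C.logZ ⬝ᵥ p.1 + C.logZ ⬝ᵥ p.2 = b
    then sign (a * (C.logZ ⬝ᵥ p.1)) else 0 with hφ
  have hφa : ∀ p, φ p = if p.1 ∈ checkKernel C.zGens ∧ p.2 ∈ checkKernel C.zGens ∧
    C.logZ ⬝ᵥ p.1 + C.logZ ⬝ᵥ p.2 = b
    then sign (a * (C.logZ ⬝ᵥ p.1)) else 0 := fun p => rfl
  have hlog : C.logZ ⬝ᵥ C.logX = 1 := by rw [dotProduct_comm]; exact C.log_anticomm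
  have hne : φ ≠ 0 := by
    intro h
    have h1 := hφa (0, b • C.logX)
    rw [h, if_pos] at h1
    · simp at h1
    · refine ⟨zero_mem _, Submodule.smul_mem _ _ C.logX_mem_checkKernel, ?_⟩
      simp [hlog]
  have hz : ∀ s t : E → ZMod 2, ∀ c : ℂ, pauliZ s t φ = c • φ →
      pauliZ s t (((‖φ‖⁻¹ : ℝ) : ℂ) • φ) = c • (((‖φ‖⁻¹ : ℝ) : ℂ) • φ) := by
    intro s t c h
    rw [smul_comm, ← h]
    ext p
    simp
    ring
  have hx : ∀ s t : E → ZMod 2, ∀ c : ℂ, pauliX s t φ = c • φ →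
      pauliX s t (((‖φ‖⁻¹ : ℝ) : ℂ) • φ) = c • (((‖φ‖⁻¹ : ℝ) : ℂ) • φ) := by
    intro s t c h
    rw [smul_comm, ← h]
    ext p
    simp
  have hmem : ∀ g ∈ C.xGens, ∀ u, u + g ∈ checkKernel C.zGens ↔ u ∈ checkKernel C.zGens :=
    fun g hg u => Submodule.add_mem_iff_left _ (C.xGens_le_checkKernel (Submodule.subset_span hg))
  have hdot : ∀ g ∈ C.xGens, C.logZ ⬝ᵥ g = 0 := fun g hg =>
    C.logZ_dotProduct_eq_zero (Submodule.subset_span hg)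
  refine ⟨((‖φ‖⁻¹ : ℝ) : ℂ) • φ, ?_, fun g hg => ?_, fun g hg => ?_, fun h hh => ?_,
    fun h hh => ?_, hx _ _ _ ?_, hz _ _ _ ?_⟩
  · rw [norm_smul, Complex.norm_real, norm_inv, norm_norm, inv_mul_cancel₀ (norm_ne_zero_iff.2 hne)]
  · have := hx g 0 1
    rw [one_smul, one_smul] at this
    refine this ?_
    ext p
    rw [pauliX_apply, hφa, hφa]
    simp [hmem g hg, hdot g hg, dotProduct_add]
  · have := hx 0 g 1
    rw [one_smul, one_smul] at this
    refine this ?_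
    ext p
    rw [pauliX_apply, hφa, hφa]
    simp [hmem g hg, hdot g hg, dotProduct_add]
  · have := hz h 0 1
    rw [one_smul, one_smul] at this
    refine this ?_
    ext p
    rw [pauliZ_apply, hφa]
    split_ifs with hp
    · rw [hp.1 h hh]; simp
    · simp
  · have := hz 0 h 1
    rw [one_smul, one_smul] at this
    refine this ?_
    ext p
    rw [pauliZ_apply, hφa]
    split_ifs with hp
    · rw [hp.2.1 h hh]; simp
    · simp
  · ext p
    have hm : ∀ u, u + C.logX ∈ checkKernel C.zGens ↔ u ∈ checkKernel C.zGens :=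
      fun u => Submodule.add_mem_iff_left _ C.logX_mem_checkKernel
    have hj : ∀ j k : ZMod 2, j + 1 + (k + 1) = j + k := by decide
    rw [pauliX_apply, PiLp.smul_apply, hφa, hφa]
    simp only [hm, dotProduct_add, hlog, hj, mul_add, mul_one, sign_add, smul_eq_mul, mul_ite,
      mul_zero]
    simp only [mul_comm]
  · ext p
    rw [pauliZ_apply, PiLp.smul_apply, hφa]
    split_ifs with hp
    · rw [hp.2.2, smul_eq_mul]
    · simp

variable {C : CSSCode E} {a b : ZMod 2} {ψ : TwoCopyState E}

theorem IsLogicalBellState.inner_eq_zero (hψ : IsLogicalBellState C a b ψ) {x z : E → ZMod 2}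
    (h : (x, z) ∉ C.sector a b) : inner ℂ (bellProduct x z) ψ = 0 := by
  by_contra hne
  have hX : ∀ s c, pauliX s s ψ = sign c • ψ → s ⬝ᵥ x = c := fun s c hs => by
    by_contra hc
    exact hne (inner_eq_zero_of_pauliX_eigen (pauliX_diag_bellProduct s x z) hs hc)
  have hZ : ∀ s c, pauliZ s s ψ = sign c • ψ → s ⬝ᵥ z = c := fun s c hs => by
    by_contra hc
    exact hne (inner_eq_zero_of_pauliZ_eigen (pauliZ_diag_bellProduct s x z) hs hc)
  refine h ⟨⟨fun g hg => hX g 0 ?_, hX _ _ hψ.logXX⟩, fun g hg => hZ g 0 ?_, hZ _ _ hψ.logZZ⟩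
  · have := pauliX_pauliX g 0 0 g ψ
    rw [add_zero, zero_add, hψ.x_stab_snd g hg, hψ.x_stab_fst g hg] at this
    rw [← this, sign_zero, one_smul]
  · have := pauliZ_pauliZ g 0 0 g ψ
    rw [add_zero, zero_add, hψ.z_stab_snd g hg, hψ.z_stab_fst g hg] at this
    rw [← this, sign_zero, one_smul]

/-- A stabilizer acting on the first copy alone fixes the state but shifts the Bell products. -/
theorem IsLogicalBellState.norm_inner_add (hψ : IsLogicalBellState C a b ψ) {s t : E → ZMod 2}
    (hs : s ∈ Submodule.span (ZMod 2) C.zGens) (ht : t ∈ Submodule.span (ZMod 2) C.xGens)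
    (x z : E → ZMod 2) :
    ‖inner ℂ (bellProduct (x + s) (z + t)) ψ‖ = ‖inner ℂ (bellProduct x z) ψ‖ := by
  have h1 : ∀ x z, ‖inner ℂ (bellProduct (x + s) z) ψ‖ = ‖inner ℂ (bellProduct x z) ψ‖ := by
    have hs' : pauliZ s 0 ψ = ψ := by
      induction hs using Submodule.span_induction with
      | mem y hy => exact hψ.z_stab_fst y hy
      | zero => ext p; simp
      | add y y' _ _ h h' =>
        rw [← add_zero (0 : E → ZMod 2), ← pauliZ_pauliZ, h', h]
      | smul c y _ h =>
        by_cases hc : c = 0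
        · subst hc; ext p; simp
        · rwa [zmod_two_eq_one_of_ne_zero hc, one_smul]
    intro x z
    have h := inner_pauliZ_left s 0 (bellProduct x z) ψ
    rw [hs', pauliZ_bellProduct, inner_smul_left, add_zero] at h
    rw [← h, norm_mul, conj_sign, norm_sign, one_mul]
  have h2 : ∀ x z, ‖inner ℂ (bellProduct x (z + t)) ψ‖ = ‖inner ℂ (bellProduct x z) ψ‖ := by
    have ht' : pauliX t 0 ψ = ψ := by
      induction ht using Submodule.span_induction with
      | mem y hy => exact hψ.x_stab_fst y hy
      | zero => ext p; simp
      | add y y' _ _ h h' =>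
        rw [← add_zero (0 : E → ZMod 2), ← pauliX_pauliX, h', h]
      | smul c y _ h =>
        by_cases hc : c = 0
        · subst hc; ext p; simp
        · rwa [zmod_two_eq_one_of_ne_zero hc, one_smul]
    intro x z
    have h := inner_pauliX_left t 0 (bellProduct x z) ψ
    rw [ht', pauliX_bellProduct, inner_smul_left, add_zero] at h
    rw [← h, norm_mul, conj_sign, norm_sign, one_mul]
  rw [h1, h2]

open Classical in
/-- In a logical Bell state, all outcomes in the sector of the state are equally likely, since
stabilizers act transitively on them. -/
theorem IsLogicalBellState.norm_inner_sq (hC : C.EncodesOneQubit)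
    (hψ : IsLogicalBellState C a b ψ) (x z : E → ZMod 2) :
    ‖inner ℂ (bellProduct x z) ψ‖ ^ 2 =
      if (x, z) ∈ C.sector a b then (Nat.card (C.sector 0 0) : ℝ)⁻¹ else 0 := by
  have hconst : ∀ p ∈ C.sector a b, ∀ q ∈ C.sector a b,
      ‖inner ℂ (bellProduct p.1 p.2) ψ‖ ^ 2 = ‖inner ℂ (bellProduct q.1 q.2) ψ‖ ^ 2 := by
    intro p hp q hq
    have h := hψ.norm_inner_add (hC.mem_span_zGens (p.1 - q.1) (sub_mem hp.1.1 hq.1.1)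
      (by rw [dotProduct_sub, hp.1.2, hq.1.2, sub_self]))
      (hC.mem_span_xGens (p.2 - q.2) (sub_mem hp.2.1 hq.2.1)
      (by rw [dotProduct_sub, hp.2.2, hq.2.2, sub_self])) q.1 q.2
    rw [← h, add_sub_cancel, add_sub_cancel]
  split_ifs with hxz
  · have h := sum_norm_inner_bellProduct_sq ψ
    rw [hψ.norm_eq_one, ← Fintype.sum_prod_type'
      (f := fun x z => ‖inner ℂ (bellProduct x z) ψ‖ ^ 2)] at h
    rw [← Finset.sum_filter_add_sum_filter_not _ (fun p => p ∈ C.sector a b),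
      Finset.sum_congr rfl (fun p hp => hconst p (Finset.mem_filter.1 hp).2 _ hxz),
      Finset.sum_eq_zero (s := Finset.univ.filter fun p => ¬ p ∈ C.sector a b) (fun p hp => by
        rw [hψ.inner_eq_zero (Finset.mem_filter.1 hp).2]; simp), add_zero, Finset.sum_const,
      nsmul_eq_mul, one_pow] at h
    rw [← C.card_sector a b, Nat.card_eq_fintype_card, Fintype.card_subtype]
    exact eq_inv_of_mul_eq_one_right h
  · rw [hψ.inner_eq_zero hxz]; simp

/-! ### The efficiency as a counting problem -/

/-- The record of the outcome `(x, z)` is shared only with outcomes that have the same logical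
bits. -/
def CSSCode.Unambiguous (C : CSSCode E) (F : E → PhysicalBM) (x z : E → ZMod 2) : Prop :=
  ∀ x' ∈ checkKernel C.xGens, ∀ z' ∈ checkKernel C.zGens, record F x' z' = record F x z →
    C.logX ⬝ᵥ x' = C.logX ⬝ᵥ x ∧ C.logZ ⬝ᵥ z' = C.logZ ⬝ᵥ z

/-- The fraction of unambiguous outcomes among those with trivial syndrome. -/
def CSSCode.unambiguousFraction (C : CSSCode E) (F : E → PhysicalBM) : ℝ :=
  Nat.card {p : checkKernel C.xGens × checkKernel C.zGens // C.Unambiguous F p.1 p.2} /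
    (Nat.card (checkKernel C.xGens) * Nat.card (checkKernel C.zGens))

open Classical in
/-- A record is impossible exactly if no outcome in the sector of the state gives it. -/
theorem recordProb_eq_zero_iff (hC : C.EncodesOneQubit) (hψ : IsLogicalBellState C a b ψ)
    (F : E → PhysicalBM) (r : Record E) :
    recordProb F ψ r = 0 ↔ ∀ x z, (x, z) ∈ C.sector a b → record F x z ≠ r := by
  have hpos : (Nat.card (C.sector 0 0) : ℝ)⁻¹ ≠ 0 := by
    have : Nonempty (C.sector 0 0) := ⟨⟨(0, 0), by simp [CSSCode.sector]⟩⟩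
    exact inv_ne_zero (Nat.cast_ne_zero.2 Nat.card_pos.ne')
  have hnn : ∀ x z, 0 ≤ if record F x z = r then ‖inner ℂ (bellProduct x z) ψ‖ ^ 2 else 0 := by
    intro x z; split_ifs <;> positivity
  unfold recordProb
  rw [Finset.sum_eq_zero_iff_of_nonneg fun x _ => Finset.sum_nonneg fun z _ => hnn x z]
  simp only [Finset.mem_univ, true_imp_iff]
  refine forall_congr' fun x => ?_
  rw [Finset.sum_eq_zero_iff_of_nonneg fun z _ => hnn x z]
  simp only [Finset.mem_univ, true_imp_iff, hψ.norm_inner_sq hC]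
  refine forall_congr' fun z => ?_
  split_ifs with h1 h2 <;> simp_all

open Classical in
/-- With equally likely outcomes, the success probability is the fraction of unambiguous ones. -/
theorem CSSCode.EncodesOneQubit.hasEfficiency (hC : C.EncodesOneQubit) (F : E → PhysicalBM) :
    HasEfficiency C F (C.unambiguousFraction F) := by
  refine ⟨⟨fun a b => (C.exists_isLogicalBellState a b).choose,
    fun a b => (C.exists_isLogicalBellState a b).choose_spec⟩, fun Φ hΦ => ?_⟩
  have hid : ∀ x z, ∀ a b, (x, z) ∈ C.sector a b →
      (Identifies F Φ (record F x z) a b ↔ C.Unambiguous F x z) := by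
    intro x z a b hxz
    simp only [Identifies, CSSCode.Unambiguous]
    constructor
    · intro h x' hx' z' hz' hr
      by_contra hne
      have hne' : (C.logX ⬝ᵥ x', C.logZ ⬝ᵥ z') ≠ (a, b) := by
        rw [← hxz.1.2, ← hxz.2.2]
        simpa [Prod.ext_iff] using hne
      exact (recordProb_eq_zero_iff hC (hΦ _ _) F _).1 (h _ _ hne') x' z'
        ⟨⟨hx', rfl⟩, hz', rfl⟩ hr
    · intro h a' b' hne
      refine (recordProb_eq_zero_iff hC (hΦ _ _) F _).2 fun x' z' hs hr => hne ?_
      obtain ⟨h1, h2⟩ := h x' hs.1.1 z' hs.2.1 hr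
      rw [← hs.1.2, ← hs.2.2, h1, h2, hxz.1.2, hxz.2.2]
  set κ : ℝ := (Nat.card (C.sector 0 0) : ℝ)⁻¹ with hκ
  -- each trivial-syndrome outcome lies in exactly one of the four sectors
  have hsum : ∀ (f : ℝ) (p : (E → ZMod 2) × (E → ZMod 2)),
      ∑ a, ∑ b, (if p ∈ C.sector a b then f else 0) =
        if p.1 ∈ checkKernel C.xGens ∧ p.2 ∈ checkKernel C.zGens then f else 0 := by
    intro f p
    rw [Finset.sum_eq_single (C.logX ⬝ᵥ p.1), Finset.sum_eq_single (C.logZ ⬝ᵥ p.2)]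
    · simp [CSSCode.sector]
    · intro b _ hb; exact if_neg fun h => hb h.2.2.symm
    · simp
    · intro a _ ha
      exact Finset.sum_eq_zero fun b _ => if_neg fun h => ha h.1.2.symm
    · simp
  have hcard : (Nat.card (checkKernel C.xGens) * Nat.card (checkKernel C.zGens) : ℝ) =
      4 * Nat.card (C.sector 0 0) := by
    have h1 : ∀ a b, ∑ p, (if p ∈ C.sector a b then (1 : ℝ) else 0) = Nat.card (C.sector 0 0) := by
      intro a b
      rw [Finset.sum_boole, ← C.card_sector a b, Nat.card_eq_fintype_card, Fintype.card_subtype]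
    have h2 : ∑ p, ∑ a, ∑ b, (if p ∈ C.sector a b then (1 : ℝ) else 0) =
        4 * Nat.card (C.sector 0 0) := by
      rw [Finset.sum_comm]
      simp only [Finset.sum_comm (s := Finset.univ (α := (E → ZMod 2) × (E → ZMod 2))), h1]
      simp only [Finset.sum_const, Finset.card_univ, ZMod.card, nsmul_eq_mul]
      push_cast; ring
    rw [← h2, ← Nat.cast_mul, ← Nat.card_prod]
    simp only [hsum]
    rw [Finset.sum_boole, ← Fintype.card_subtype, ← Nat.card_eq_fintype_card]
    congr 1
    exact Nat.card_congr (Equiv.subtypeProdEquivProd (p := fun x => x ∈ checkKernel C.xGens)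
      (q := fun z => z ∈ checkKernel C.zGens)).symm
  have hrec : ∀ a b, (∑ r : Record E,
      if Identifies F Φ r a b then recordProb F (Φ a b) r else 0) =
        ∑ p : (E → ZMod 2) × (E → ZMod 2), if p ∈ C.sector a b then
          (if C.Unambiguous F p.1 p.2 then κ else 0) else 0 := by
    intro a b
    simp only [recordProb, (hΦ a b).norm_inner_sq hC]
    simp only [← Fintype.sum_prod_type' (f := fun x z => if record F x z = _ then
      (if (x, z) ∈ C.sector a b then (Nat.card (C.sector 0 0) : ℝ)⁻¹ else 0) else 0)]
    have : ∀ r : Record E, (if Identifies F Φ r a b then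
        ∑ p : (E → ZMod 2) × (E → ZMod 2), (if record F p.1 p.2 = r then
          (if (p.1, p.2) ∈ C.sector a b then (Nat.card (C.sector 0 0) : ℝ)⁻¹ else 0) else 0) else 0) =
        ∑ p : (E → ZMod 2) × (E → ZMod 2), (if record F p.1 p.2 = r then
          (if Identifies F Φ r a b then
            (if (p.1, p.2) ∈ C.sector a b then κ else 0) else 0) else 0) := by
      intro r
      split_ifs with h
      · rfl
      · simp
    simp only [this]
    rw [Finset.sum_comm]
    refine Finset.sum_congr rfl fun p _ => ?_
    rw [Finset.sum_ite_eq, if_pos (Finset.mem_univ _)]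
    by_cases hp : p ∈ C.sector a b
    · simp only [Prod.mk.eta, hp, if_true, hid p.1 p.2 a b hp]
    · simp [hp]
  unfold successProb
  simp only [hrec]
  have hswap : (∑ a, ∑ b, ∑ p : (E → ZMod 2) × (E → ZMod 2), if p ∈ C.sector a b then
          (if C.Unambiguous F p.1 p.2 then κ else 0) else 0) =
      ∑ p : (E → ZMod 2) × (E → ZMod 2), ∑ a, ∑ b, if p ∈ C.sector a b then
          (if C.Unambiguous F p.1 p.2 then κ else 0) else 0 := by
    rw [Finset.sum_comm]
    simp only [Finset.sum_comm (s := Finset.univ (α := (E → ZMod 2) × (E → ZMod 2)))]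
    rw [Finset.sum_comm]
  rw [hswap]
  simp only [hsum]
  have hcount : (Nat.card {p : checkKernel C.xGens × checkKernel C.zGens //
      C.Unambiguous F p.1 p.2} : ℝ) * κ = ∑ p : (E → ZMod 2) × (E → ZMod 2),
      if p.1 ∈ checkKernel C.xGens ∧ p.2 ∈ checkKernel C.zGens then
        (if C.Unambiguous F p.1 p.2 then κ else 0) else 0 := by
    simp only [← ite_and]
    rw [← Finset.sum_filter, Finset.sum_const, nsmul_eq_mul, ← Fintype.card_subtype,
      ← Nat.card_eq_fintype_card]
    congr 2
    exact Nat.card_congr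
      { toFun := fun p => ⟨(p.1.1, p.1.2), ⟨p.1.1.2, p.1.2.2⟩, p.2⟩
        invFun := fun p => ⟨(⟨p.1.1, p.2.1.1⟩, ⟨p.1.2, p.2.1.2⟩), p.2.2⟩
        left_inv := fun _ => rfl
        right_inv := fun _ => rfl }
  rw [← hcount, CSSCode.unambiguousFraction, hcard, hκ, div_mul_eq_div_div_swap]
  ring

end Code

/-! ### Efficiency of a path of `ZZ = 1` Bell measurements -/

section Path

variable {E : Type*}

/-- Two outcomes give the same record exactly if their guaranteed bits agree, and also the other bit
wherever it is obtained. -/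
theorem record_eq_iff {p : E → ZMod 2} {F : E → PhysicalBM}
    (hF : ∀ e, F e = if p e = 1 then .zz1 else .xx1) {x z x' z' : E → ZMod 2} :
    record F x' z' = record F x z ↔
      ∀ e, (p e = 1 → z' e = z e ∧ (z e = 1 → x' e = x e)) ∧
        (p e = 0 → x' e = x e ∧ (x e = 1 → z' e = z e)) := by
  rw [funext_iff]
  refine forall_congr' fun e => ?_
  by_cases hp : p e = 1
  · simp only [record, hF, hp, if_true, PhysicalBM.reading, Prod.mk.injEq, Option.some.injEq]
    by_cases h : z' e = z e
    · by_cases h1 : z e = 1 <;> simp [h, h1]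
    · simp [h]
  · have hp0 : p e = 0 := by
      by_contra h; exact hp (zmod_two_eq_one_of_ne_zero h)
    simp only [record, hF, PhysicalBM.reading, hp0]
    by_cases h : x' e = x e
    · by_cases h1 : x e = 1 <;> simp [h, h1]
    · simp [h]

variable [Fintype E]

/-- `p` is the support of a representative of `Z̄` that contains no other nonempty support of an
operator commuting with the `X`-stabilizers: like a self-avoiding lattice path between the two
rough boundaries of a surface code. -/
structure CSSCode.IsMinimalPath (C : CSSCode E) (p : E → ZMod 2) : Prop where
  mem : p ∈ checkKernel C.xGens
  logX : C.logX ⬝ᵥ p = 1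
  eq_zero_or_eq : ∀ x ∈ checkKernel C.xGens, (∀ e, p e = 0 → x e = 0) → x = 0 ∨ x = p

variable {C : CSSCode E} {p : E → ZMod 2}

/-- The logical `ZZ`-bit is always read off along the path, and the logical `XX`-bit fails to be
determined only when all `XX`-bits on the path are missing. -/
theorem CSSCode.IsMinimalPath.unambiguous_iff (hC : C.EncodesOneQubit) (hp : C.IsMinimalPath p)
    {F : E → PhysicalBM} (hF : ∀ e, F e = if p e = 1 then .zz1 else .xx1) {x z : E → ZMod 2}
    (hx : x ∈ checkKernel C.xGens) (hz : z ∈ checkKernel C.zGens) :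
    C.Unambiguous F x z ↔ ∃ e, p e = 1 ∧ z e ≠ 0 := by
  constructor
  · intro h
    by_contra! hz0
    -- adding the whole path to `x` flips the logical bit but not the record
    have := (h (x + p) (add_mem hx hp.mem) z hz ((record_eq_iff hF).2 fun e =>
      ⟨fun he => ⟨rfl, fun h1 => by simp [hz0 e he] at h1⟩,
        fun he => ⟨by simp [he], fun _ => rfl⟩⟩)).1
    rw [dotProduct_add, hp.logX] at this
    simp at this
  · rintro ⟨e, he, hze⟩ x' hx' z' hz' hr
    rw [record_eq_iff hF] at hr
    have hdiff : x' - x = 0 := by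
      refine (hp.eq_zero_or_eq _ (sub_mem hx' hx) fun i hi => ?_).resolve_right fun h => ?_
      · simp [((hr i).2 hi).1]
      · have h1 := congrFun h e
        rw [Pi.sub_apply, ((hr e).1 he).2 (zmod_two_eq_one_of_ne_zero hze), he, sub_self] at h1
        exact zero_ne_one h1
    refine ⟨by rw [sub_eq_zero.1 hdiff], ?_⟩
    -- `Z̄` agrees with `Z` along the path up to stabilizers
    have hlog : ∀ w ∈ checkKernel C.zGens, C.logZ ⬝ᵥ w = p ⬝ᵥ w := by
      intro w hw
      have h := dotProduct_eq_zero_of_mem_span hw (hC.mem_span_zGens (C.logZ - p)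
        (sub_mem C.logZ_mem_checkKernel hp.mem)
        (by rw [dotProduct_sub, C.log_anticomm, hp.logX, sub_self]))
      rwa [sub_dotProduct, sub_eq_zero] at h
    rw [hlog z' hz', hlog z hz]
    refine Finset.sum_congr rfl fun i _ => ?_
    by_cases hi : p i = 1
    · rw [((hr i).1 hi).1]
    · rw [show p i = 0 by by_contra h; exact hi (zmod_two_eq_one_of_ne_zero h), zero_mul, zero_mul]

/-- Restriction of the `ZZ`-bits to the path. -/
def restrictToPath (C : CSSCode E) (p : E → ZMod 2) :
    checkKernel C.zGens →ₗ[ZMod 2] ({e // p e = 1} → ZMod 2) :=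
  (LinearMap.funLeft (ZMod 2) (ZMod 2) Subtype.val).comp (checkKernel C.zGens).subtype

/-- The `ZZ`-bits on the path are independent and uniform: a parity check on them would be an
operator supported on the path that commutes with `X̄` and with all `X`-stabilizers. -/
theorem CSSCode.IsMinimalPath.restrictToPath_surjective
    (hp : C.IsMinimalPath p) : Function.Surjective (restrictToPath C p) := by
  classical
  rw [← LinearMap.range_eq_top]
  by_contra hne
  obtain ⟨φ, hφ, hle⟩ := Submodule.exists_le_ker_of_lt_top _ (lt_top_iff_ne_top.2 hne)
  -- the functional `φ` vanishing on the image, as a vector supported on the path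
  set x : E → ZMod 2 := fun e => if h : p e = 1 then φ (Pi.single ⟨e, h⟩ 1) else 0 with hx
  have hdot : ∀ z : E → ZMod 2, z ⬝ᵥ x = φ (fun e => z e) := by
    intro z
    rw [LinearMap.pi_apply_eq_sum_univ φ, dotProduct,
      ← Finset.sum_filter_of_ne (p := fun e => p e = 1) fun e _ h => by
        by_contra he; simp [hx, he] at h,
      Finset.sum_subtype (p := fun e => p e = 1) _ (by simp)]
    refine Finset.sum_congr rfl fun e _ => ?_
    rw [hx, smul_eq_mul]
    simp only [e.2, dite_true]
    congr 2
    ext i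
    simp [Pi.single_apply, eq_comm]
  have hz : ∀ z ∈ checkKernel C.zGens, z ⬝ᵥ x = 0 := fun z hz => by
    rw [hdot]
    exact hle ⟨⟨z, hz⟩, rfl⟩
  rcases hp.eq_zero_or_eq x
    (fun g hg => hz g (C.xGens_le_checkKernel (Submodule.subset_span hg)))
    (fun e he => by simp [hx, he]) with h | h
  · refine hφ (LinearMap.ext fun y => ?_)
    have := hdot fun e => if h : p e = 1 then y ⟨e, h⟩ else 0
    rw [h, dotProduct_zero] at this
    rw [LinearMap.zero_apply, this]
    congr 1
    ext ⟨e, he⟩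
    simp [he]
  · have h1 := hz _ C.logX_mem_checkKernel
    rw [h, hp.logX] at h1
    exact one_ne_zero h1

/-- An outcome is ambiguous exactly if its `ZZ`-bits vanish on the path, which has probability
`2 ^ (-|p|)`. -/
theorem CSSCode.IsMinimalPath.unambiguousFraction_eq (hC : C.EncodesOneQubit)
    (hp : C.IsMinimalPath p)
    {F : E → PhysicalBM} (hF : ∀ e, F e = if p e = 1 then .zz1 else .xx1) :
    C.unambiguousFraction F = 1 - (1 / 2) ^ Nat.card {e // p e = 1} := by
  classical
  rw [Nat.card_eq_fintype_card]
  set ρ := restrictToPath C p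
  have hsurj := hp.restrictToPath_surjective
  have hW : Nat.card (checkKernel C.zGens) =
      2 ^ Fintype.card {e // p e = 1} * Nat.card (LinearMap.ker ρ) := by
    rw [Submodule.card_eq_card_quotient_mul_card (LinearMap.ker ρ), mul_comm,
      Nat.card_congr (ρ.quotKerEquivOfSurjective hsurj).toEquiv]
    simp
  have hcard : (Nat.card {q : checkKernel C.xGens × checkKernel C.zGens //
      C.Unambiguous F q.1 q.2} : ℝ) = Nat.card (checkKernel C.xGens) *
        (Nat.card (checkKernel C.zGens) - Nat.card (LinearMap.ker ρ)) := by
    have h1 : ∀ q : checkKernel C.xGens × checkKernel C.zGens,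
        C.Unambiguous F q.1 q.2 ↔ q.2 ∉ LinearMap.ker ρ := by
      intro q
      rw [hp.unambiguous_iff hC hF q.1.2 q.2.2, LinearMap.mem_ker, funext_iff, not_forall]
      exact ⟨fun ⟨e, he, h⟩ => ⟨⟨e, he⟩, h⟩, fun ⟨e, h⟩ => ⟨e, e.2, h⟩⟩
    have h2 : Nat.card {q : checkKernel C.xGens × checkKernel C.zGens //
        C.Unambiguous F q.1 q.2} =
        Nat.card (checkKernel C.xGens × {w // w ∉ LinearMap.ker ρ}) :=
      Nat.card_congr
        { toFun := fun q => (q.1.1, ⟨q.1.2, (h1 _).1 q.2⟩)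
          invFun := fun q => ⟨(q.1, q.2.1), (h1 _).2 q.2.2⟩
          left_inv := fun _ => rfl
          right_inv := fun _ => rfl }
    rw [h2, Nat.card_prod, Nat.cast_mul, Nat.card_eq_fintype_card (α := {w // w ∉ LinearMap.ker ρ}),
      Fintype.card_subtype_compl, Nat.cast_sub (Fintype.card_subtype_le _),
      ← Nat.card_eq_fintype_card, ← Nat.card_eq_fintype_card]
  have hV0 : (Nat.card (checkKernel C.xGens) : ℝ) ≠ 0 := Nat.cast_ne_zero.2 Nat.card_pos.ne'
  have hK0 : (Nat.card (LinearMap.ker ρ) : ℝ) ≠ 0 := Nat.cast_ne_zero.2 Nat.card_pos.ne'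
  rw [CSSCode.unambiguousFraction, hcard, mul_div_mul_left _ _ hV0, hW]
  push_cast
  rw [one_div, inv_pow]
  field_simp

end Path

/-! ### Exchanging the roles of `X` and `Z` -/

section Dual

variable {E : Type*}

/-- The Bell measurement with the roles of `X` and `Z` exchanged. -/
def PhysicalBM.dual : PhysicalBM → PhysicalBM
  | .zz1 => .xx1
  | .xx1 => .zz1

theorem PhysicalBM.reading_dual (B : PhysicalBM) (x z : ZMod 2) :
    B.dual.reading z x = (B.reading x z).swap := by
  cases B <;> rfl

theorem record_dual_eq_iff (F : E → PhysicalBM) (x z x' z' : E → ZMod 2) :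
    record (fun e => (F e).dual) z' x' = record (fun e => (F e).dual) z x ↔
      record F x' z' = record F x z := by
  simp only [funext_iff, record, PhysicalBM.reading_dual, Prod.swap_inj]

variable [Fintype E]

/-- The code with the roles of `X` and `Z` exchanged. -/
def CSSCode.dual (C : CSSCode E) : CSSCode E where
  xGens := C.zGens
  zGens := C.xGens
  logX := C.logZ
  logZ := C.logX
  gens_comm g hg h hh := by rw [dotProduct_comm]; exact C.gens_comm h hh g hg
  logX_comm h hh := by rw [dotProduct_comm]; exact C.logZ_comm h hh
  logZ_comm g hg := by rw [dotProduct_comm]; exact C.logX_comm g hg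
  log_anticomm := by rw [dotProduct_comm]; exact C.log_anticomm

theorem CSSCode.EncodesOneQubit.dual {C : CSSCode E} (hC : C.EncodesOneQubit) :
    C.dual.EncodesOneQubit := ⟨hC.mem_span_xGens, hC.mem_span_zGens⟩

theorem CSSCode.unambiguous_dual (C : CSSCode E) (F : E → PhysicalBM) (x z : E → ZMod 2) :
    C.dual.Unambiguous (fun e => (F e).dual) z x ↔ C.Unambiguous F x z :=
  ⟨fun h x' hx' z' hz' hr => (h z' hz' x' hx' ((record_dual_eq_iff F x z x' z').2 hr)).symm,
    fun h z' hz' x' hx' hr => (h x' hx' z' hz' ((record_dual_eq_iff F x z x' z').1 hr)).symm⟩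

theorem CSSCode.unambiguousFraction_dual (C : CSSCode E) (F : E → PhysicalBM) :
    C.dual.unambiguousFraction (fun e => (F e).dual) = C.unambiguousFraction F := by
  have h : Nat.card {q : checkKernel C.zGens × checkKernel C.xGens //
      C.dual.Unambiguous (fun e => (F e).dual) q.1 q.2} =
      Nat.card {q : checkKernel C.xGens × checkKernel C.zGens // C.Unambiguous F q.1 q.2} :=
    Nat.card_congr ((Equiv.prodComm _ _).subtypeEquiv fun q => C.unambiguous_dual F q.2 q.1)
  unfold CSSCode.unambiguousFraction
  rw [← h, mul_comm]
  rfl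

end Dual

/-! ### Edge vectors of the planar lattice -/

section Surface

variable {n m : ℕ}

/-- The entry at the horizontal edge `(i, c)`, and `0` outside of the lattice. -/
def hEntry (x : Edge n m → ZMod 2) (i c : ℕ) : ZMod 2 :=
  if h : i < m ∧ c < n then x (.inl (⟨i, h.1⟩, ⟨c, h.2⟩)) else 0

/-- The entry at the vertical edge in column `c` whose lower end is in row `i`, i.e. at the
vertical edge `(i - 1, c)`, and `0` outside of the lattice. -/
def vEntry (x : Edge n m → ZMod 2) (i c : ℕ) : ZMod 2 :=
  if h : (1 ≤ i ∧ i - 1 < m - 1) ∧ c < n - 1 then x (.inr (⟨i - 1, h.1.2⟩, ⟨c, h.2⟩)) else 0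

theorem hEntry_coe (x : Edge n m → ZMod 2) (e : Fin m × Fin n) :
    hEntry x e.1 e.2 = x (.inl e) := by
  simp [hEntry]

theorem vEntry_coe (x : Edge n m → ZMod 2) (e : Fin (m - 1) × Fin (n - 1)) :
    vEntry x (e.1 + 1) e.2 = x (.inr e) := by
  simp [vEntry]

theorem sum_prod_fin_ite {k l : ℕ} (i c : ℕ) (g : Fin k × Fin l → ZMod 2) :
    (∑ e, if e.1.val = i ∧ e.2.val = c then g e else 0) =
      if h : i < k ∧ c < l then g (⟨i, h.1⟩, ⟨c, h.2⟩) else 0 := by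
  split_ifs with h
  · rw [Finset.sum_eq_single (⟨i, h.1⟩, ⟨c, h.2⟩)]
    · simp
    · rintro ⟨a, b⟩ _ hne
      exact if_neg fun h' => hne (Prod.ext (Fin.ext h'.1) (Fin.ext h'.2))
    · simp
  · refine Finset.sum_eq_zero fun e _ => if_neg fun h' => h ?_
    rw [← h'.1, ← h'.2]
    exact ⟨e.1.2, e.2.2⟩

theorem vertex_dotProduct (p : Fin m × Fin (n - 1)) (x : Edge n m → ZMod 2) :
    vertex n m p ⬝ᵥ x = hEntry x p.1 p.2 + hEntry x p.1 (p.2 + 1) +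
      vEntry x (p.1 + 1) p.2 + vEntry x p.1 p.2 := by
  obtain ⟨r, c⟩ := p
  have h1 : ∀ e : Fin m × Fin n, vertex n m (r, c) (.inl e) * x (.inl e) =
      (if e.1.val = r.val ∧ e.2.val = c.val then x (.inl e) else 0) +
      (if e.1.val = r.val ∧ e.2.val = c.val + 1 then x (.inl e) else 0) := by
    intro e
    simp only [vertex]
    split_ifs <;> first | (exfalso; omega) | simp
  have h2 : ∀ e : Fin (m - 1) × Fin (n - 1), vertex n m (r, c) (.inr e) * x (.inr e) =
      (if e.1.val = r.val ∧ e.2.val = c.val then x (.inr e) else 0) +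
      (if r.val = 0 then 0 else
        if e.1.val = r.val - 1 ∧ e.2.val = c.val then x (.inr e) else 0) := by
    intro e
    simp only [vertex]
    split_ifs <;> first | (exfalso; omega) | simp
  rw [dotProduct, Fintype.sum_sum_type]
  simp only [h1, h2, Finset.sum_add_distrib, sum_prod_fin_ite]
  rw [← add_assoc]
  congr 1
  · simp [vEntry, hEntry]
  · by_cases hr : r.val = 0
    · simp [vEntry, hr]
    · have : 1 ≤ r.val := by omega
      simp only [hr, if_false, sum_prod_fin_ite, vEntry, this, true_and]

theorem firstColumn_dotProduct (hn : 0 < n) (x : Edge n m → ZMod 2) :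
    firstColumn n m ⬝ᵥ x = ∑ i ∈ Finset.range m, hEntry x i 0 := by
  rw [dotProduct, Fintype.sum_sum_type, Finset.sum_range, Fintype.sum_prod_type]
  simp only [firstColumn, zero_mul, Finset.sum_const_zero, add_zero]
  refine Finset.sum_congr rfl fun i _ => ?_
  rw [Finset.sum_eq_single ⟨0, hn⟩]
  · simp [hEntry, hn]
  · intro c _ hc
    rw [if_neg fun h => hc (Fin.ext h), zero_mul]
  · simp

/-! ### The planar surface code encodes one qubit -/

/-- The sum of the first `j` horizontal entries of column `c`. -/
def columnSum (x : Edge n m → ZMod 2) (j c : ℕ) : ZMod 2 := ∑ i ∈ Finset.range j, hEntry x i c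

/-- Summing the vertex conditions between two neighbouring columns telescopes. -/
theorem columnSum_add_columnSum {x : Edge n m → ZMod 2}
    (hx : x ∈ checkKernel (Set.range (vertex n m))) {j c : ℕ} (hj : j ≤ m) (hc : c + 1 < n) :
    columnSum x j c + columnSum x j (c + 1) = vEntry x j c := by
  induction j with
  | zero => simp [columnSum, vEntry]
  | succ j ih =>
    have h := hx _ ⟨(⟨j, hj⟩, ⟨c, by omega⟩), rfl⟩
    rw [vertex_dotProduct] at h
    have ih := ih (by omega)
    simp only [columnSum, Finset.sum_range_succ] at ih ⊢
    simp only at h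
    have h2 : ∀ s t u v a b : ZMod 2, s + t = v → a + b + u + v = 0 → s + a + (t + b) = u := by
      decide
    exact h2 _ _ _ _ _ _ ih h

theorem columnSum_eq_zero {x : Edge n m → ZMod 2}
    (hx : x ∈ checkKernel (Set.range (vertex n m))) (h0 : firstColumn n m ⬝ᵥ x = 0)
    {c : ℕ} (hc : c < n) : columnSum x m c = 0 := by
  induction c with
  | zero => rwa [firstColumn_dotProduct hc] at h0
  | succ c ih =>
    have h := columnSum_add_columnSum hx le_rfl hc
    rw [ih (by omega), zero_add] at h
    rw [h, vEntry, dif_neg (by omega)]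

/-- A relative cycle that is homologically trivial is the boundary of the set of faces for which
the number of its horizontal edges above the face in the same column, including the upper edge of
the face, is odd. -/
theorem eq_sum_face {x : Edge n m → ZMod 2}
    (hx : x ∈ checkKernel (Set.range (vertex n m))) (h0 : firstColumn n m ⬝ᵥ x = 0) :
    x = ∑ q : Fin (m - 1) × Fin n, columnSum x (q.1 + 1) q.2 • face n m q := by
  ext e
  rw [Finset.sum_apply]
  simp only [Pi.smul_apply, smul_eq_mul]
  rcases e with ⟨r, k⟩ | ⟨i, c⟩
  · have h1 : ∀ q : Fin (m - 1) × Fin n, columnSum x (q.1 + 1) q.2 * face n m q (.inl (r, k)) =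
        (if q.1.val = r.val ∧ q.2.val = k.val then columnSum x (q.1 + 1) q.2 else 0) +
        (if r.val = 0 then 0 else
          if q.1.val = r.val - 1 ∧ q.2.val = k.val then columnSum x (q.1 + 1) q.2 else 0) := by
      intro q
      simp only [face]
      split_ifs <;> first | (exfalso; omega) | simp
    have h2 : (∑ q : Fin (m - 1) × Fin n,
        if q.1.val = r.val ∧ q.2.val = k.val then columnSum x (q.1 + 1) q.2 else 0) =
        columnSum x (r + 1) k := by
      rw [sum_prod_fin_ite]
      split_ifs with h
      · rfl
      · have hr := r.2
        have hk := k.2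
        rw [show r.val + 1 = m by omega, columnSum_eq_zero hx h0 k.2]
    have h3 : (∑ q : Fin (m - 1) × Fin n, if r.val = 0 then 0 else
        if q.1.val = r.val - 1 ∧ q.2.val = k.val then columnSum x (q.1 + 1) q.2 else 0) =
        columnSum x r k := by
      by_cases hr : r.val = 0
      · simp [hr, columnSum]
      · have hr' := r.2
        simp only [hr, if_false]
        rw [sum_prod_fin_ite, dif_pos ⟨by omega, k.2⟩]
        simp only
        rw [Nat.sub_add_cancel (by omega)]
    simp only [h1, Finset.sum_add_distrib]
    rw [h2, h3, ← hEntry_coe x (r, k), columnSum, Finset.sum_range_succ, ← columnSum]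
    have h4 : ∀ a s : ZMod 2, a = s + a + s := by decide
    exact h4 _ _
  · have hc := c.2
    have h1 : ∀ q : Fin (m - 1) × Fin n, columnSum x (q.1 + 1) q.2 * face n m q (.inr (i, c)) =
        (if q.1.val = i.val ∧ q.2.val = c.val then columnSum x (q.1 + 1) q.2 else 0) +
        (if q.1.val = i.val ∧ q.2.val = c.val + 1 then columnSum x (q.1 + 1) q.2 else 0) := by
      intro q
      simp only [face]
      split_ifs <;> first | (exfalso; omega) | simp
    simp only [h1, Finset.sum_add_distrib]
    rw [sum_prod_fin_ite, sum_prod_fin_ite, dif_pos ⟨i.2, by omega⟩, dif_pos ⟨i.2, by omega⟩,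
      ← vEntry_coe x (i, c)]
    exact (columnSum_add_columnSum hx (by omega) (by omega)).symm

/-- Reflection of the lattice in the diagonal, which passes to the dual lattice: vertices become
faces. -/
def transposeEdge (n m : ℕ) : Edge n m ≃ Edge m n :=
  Equiv.sumCongr (Equiv.prodComm _ _) (Equiv.prodComm _ _)

theorem face_eq_vertex_transpose (q : Fin (m - 1) × Fin n) :
    face n m q = vertex m n q.swap ∘ transposeEdge n m := by
  ext e
  rcases e with e | e <;> rfl

theorem vertex_eq_face_transpose (p : Fin m × Fin (n - 1)) :
    vertex n m p = face m n p.swap ∘ transposeEdge n m := by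
  ext e
  rcases e with e | e <;> rfl

theorem firstRow_eq_firstColumn_transpose :
    firstRow n m = firstColumn m n ∘ transposeEdge n m := by
  ext e
  rcases e with e | e <;> rfl

theorem comp_transpose_dotProduct (u : Edge m n → ZMod 2) (x : Edge n m → ZMod 2) :
    (u ∘ transposeEdge n m) ⬝ᵥ x = u ⬝ᵥ (x ∘ (transposeEdge n m).symm) :=
  Fintype.sum_equiv (transposeEdge n m) _ _ fun e => by simp

theorem transpose_mem_checkKernel {z : Edge n m → ZMod 2} :
    z ∘ (transposeEdge n m).symm ∈ checkKernel (Set.range (vertex m n)) ↔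
      z ∈ checkKernel (Set.range (face n m)) := by
  simp only [mem_checkKernel, Set.forall_mem_range, face_eq_vertex_transpose,
    comp_transpose_dotProduct]
  exact ⟨fun h q => h q.swap, fun h p => h p.swap⟩

theorem surfaceCode_encodesOneQubit (n m : ℕ) (hn : 0 < n) (hm : 0 < m) :
    (surfaceCode n m hn hm).EncodesOneQubit where
  mem_span_zGens x hx h0 := by
    rw [eq_sum_face hx h0]
    exact Submodule.sum_mem _ fun q _ =>
      Submodule.smul_mem _ _ (Submodule.subset_span ⟨q, rfl⟩)
  mem_span_xGens z hz h0 := by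
    have h0' : firstColumn m n ⬝ᵥ (z ∘ (transposeEdge n m).symm) = 0 := by
      rw [← comp_transpose_dotProduct, ← firstRow_eq_firstColumn_transpose]
      exact h0
    have h := eq_sum_face (transpose_mem_checkKernel.2 hz) h0'
    have hzz : z = ∑ q : Fin (n - 1) × Fin m,
        columnSum (z ∘ (transposeEdge n m).symm) (q.1 + 1) q.2 • vertex n m q.swap := by
      ext e
      have he := congrFun h (transposeEdge n m e)
      rw [Function.comp_apply, Equiv.symm_apply_apply] at he
      rw [he, Finset.sum_apply, Finset.sum_apply]
      refine Finset.sum_congr rfl fun q _ => ?_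
      rw [vertex_eq_face_transpose]
      rfl
    rw [hzz]
    exact Submodule.sum_mem _ fun q _ =>
      Submodule.smul_mem _ _ (Submodule.subset_span ⟨q.swap, rfl⟩)

/-! ### Zig-zag paths -/

/-- The indicator of the lattice path along the horizontal edges `(r c, c)` and the vertical
edges joining the rows `r c` and `r (c + 1)`. -/
def zigzagPath (n m : ℕ) (r : ℕ → ℕ) : Edge n m → ZMod 2
  | .inl e => if e.1.val = r e.2.val then 1 else 0
  | .inr e => if e.1.val = min (r e.2.val) (r (e.2.val + 1)) then 1 else 0

theorem hEntry_zigzagPath {r : ℕ → ℕ} (hr : IsZigzag n m r) {i c : ℕ} (hc : c < n) :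
    hEntry (zigzagPath n m r) i c = if i = r c then 1 else 0 := by
  have := hr.1 c hc
  simp only [hEntry, zigzagPath]
  split_ifs <;> first | rfl | (exfalso; omega)

theorem vEntry_zigzagPath {r : ℕ → ℕ} (hr : IsZigzag n m r) {i c : ℕ} (hc : c + 1 < n) :
    vEntry (zigzagPath n m r) i c = if i = max (r c) (r (c + 1)) then 1 else 0 := by
  have h1 := hr.1 c (by omega)
  have h2 := hr.1 (c + 1) hc
  have h3 := hr.2 c hc
  simp only [vEntry, zigzagPath]
  split_ifs <;> first | rfl | (exfalso; omega)

theorem hEntry_eq_zero_of_support {x y : Edge n m → ZMod 2} (hxy : ∀ e, y e = 0 → x e = 0)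
    {i c : ℕ} (h : hEntry y i c = 0) : hEntry x i c = 0 := by
  unfold hEntry at *
  split_ifs at * with h'
  · exact hxy _ h
  · rfl

theorem vEntry_eq_zero_of_support {x y : Edge n m → ZMod 2} (hxy : ∀ e, y e = 0 → x e = 0)
    {i c : ℕ} (h : vEntry y i c = 0) : vEntry x i c = 0 := by
  unfold vEntry at *
  split_ifs at * with h'
  · exact hxy _ h
  · rfl

/-- Along a zig-zag, horizontal and vertical edges alternate, and every vertex on it has exactly
two of its edges; hence the vertex conditions force a vector supported on it to be constant. -/
theorem zigzagPath_isMinimalPath (hn : 0 < n) (hm : 0 < m) {r : ℕ → ℕ} (hr : IsZigzag n m r) :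
    (surfaceCode n m hn hm).IsMinimalPath (zigzagPath n m r) where
  mem := by
    rintro _ ⟨⟨i, c⟩, rfl⟩
    have hc := c.2
    rw [vertex_dotProduct, hEntry_zigzagPath hr (by omega), hEntry_zigzagPath hr (by omega),
      vEntry_zigzagPath hr (by omega), vEntry_zigzagPath hr (by omega)]
    have h3 := hr.2 c (by omega)
    simp only
    split_ifs <;> first | decide | (exfalso; omega)
  logX := by
    change firstColumn n m ⬝ᵥ _ = 1
    rw [firstColumn_dotProduct hn]
    simp only [hEntry_zigzagPath hr hn, Finset.sum_ite_eq', Finset.mem_range, hr.1 0 hn, if_true]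
  eq_zero_or_eq x hx hsupp := by
    have hh : ∀ i c, c < n → i ≠ r c → hEntry x i c = 0 := fun i c hc hi =>
      hEntry_eq_zero_of_support hsupp (by rw [hEntry_zigzagPath hr hc, if_neg hi])
    have hv : ∀ i c, c + 1 < n → i ≠ max (r c) (r (c + 1)) → vEntry x i c = 0 := fun i c hc hi =>
      vEntry_eq_zero_of_support hsupp (by rw [vEntry_zigzagPath hr hc, if_neg hi])
    have hcancel : ∀ a b : ZMod 2, a + b = 0 → a = b := by decide
    have hvert : ∀ i c, i < m → c + 1 < n →
        hEntry x i c + hEntry x i (c + 1) + vEntry x (i + 1) c + vEntry x i c = 0 := by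
      intro i c hi hc
      have h := hx _ ⟨(⟨i, hi⟩, ⟨c, by omega⟩), rfl⟩
      rwa [vertex_dotProduct] at h
    -- the two vertices at the ends of the vertical edge after column `c`
    have hleft : ∀ c, c + 1 < n →
        hEntry x (r c) c = vEntry x (max (r c) (r (c + 1))) c := by
      intro c hc
      have h3 := hr.2 c hc
      have h := hvert (r c) c (hr.1 c (by omega)) hc
      rw [hh (r c) (c + 1) hc (by omega), add_zero] at h
      rcases h3 with h3 | h3
      · rw [hv (r c) c hc (by omega), add_zero] at h
        rw [hcancel _ _ h, h3, max_eq_right (by omega)]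
      · rw [hv (r c + 1) c hc (by omega), add_zero] at h
        rw [hcancel _ _ h, max_eq_left (by omega)]
    have hright : ∀ c, c + 1 < n →
        hEntry x (r (c + 1)) (c + 1) = vEntry x (max (r c) (r (c + 1))) c := by
      intro c hc
      have h3 := hr.2 c hc
      have h := hvert (r (c + 1)) c (hr.1 (c + 1) hc) hc
      rw [hh (r (c + 1)) c (by omega) (by omega), zero_add] at h
      rcases h3 with h3 | h3
      · rw [hv (r (c + 1) + 1) c hc (by omega), add_zero] at h
        rw [hcancel _ _ h, max_eq_right (by omega)]
      · rw [hv (r (c + 1)) c hc (by omega), add_zero] at h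
        rw [hcancel _ _ h, max_eq_left (by omega), h3]
    have hconst : ∀ c, c < n → hEntry x (r c) c = hEntry x (r 0) 0 := by
      intro c hc
      induction c with
      | zero => rfl
      | succ c ih => rw [hright c hc, ← hleft c hc, ih (by omega)]
    have hxe : ∀ e, x e = hEntry x (r 0) 0 * zigzagPath n m r e := by
      rintro (e | e)
      · have he := e.2.2
        rw [← hEntry_coe x, ← hEntry_coe (zigzagPath n m r), hEntry_zigzagPath hr he]
        split_ifs with h
        · rw [h, hconst _ he, mul_one]
        · rw [hh _ _ he h, mul_zero]
      · have he : e.2.val + 1 < n := by have := e.2.2; omega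
        rw [← vEntry_coe x, ← vEntry_coe (zigzagPath n m r), vEntry_zigzagPath hr he]
        split_ifs with h
        · rw [h, ← hleft _ he, hconst _ (by omega), mul_one]
        · rw [hv _ _ he h, mul_zero]
    by_cases h0 : hEntry x (r 0) 0 = 0
    · left
      ext e
      rw [hxe, h0, zero_mul, Pi.zero_apply]
    · right
      ext e
      rw [hxe, zmod_two_eq_one_of_ne_zero h0, one_mul]

theorem card_zigzagPath {r : ℕ → ℕ} (hr : IsZigzag n m r) :
    Nat.card {e // zigzagPath n m r e = 1} = n + (n - 1) := by
  have hmin : ∀ c : Fin (n - 1), min (r c) (r (c + 1)) < m - 1 := by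
    intro c
    have hc := c.2
    have h1 := hr.1 c (by omega)
    have h2 := hr.1 (c + 1) (by omega)
    have h3 := hr.2 c (by omega)
    omega
  have hone : ∀ P : Prop, [Decidable P] → ((if P then (1 : ZMod 2) else 0) = 1 ↔ P) := by
    intro P _
    split_ifs with h <;> simp [h]
  let f : Fin n ⊕ Fin (n - 1) → {e // zigzagPath n m r e = 1} := Sum.elim
    (fun c => ⟨.inl (⟨r c, hr.1 c c.2⟩, c), by simp [zigzagPath]⟩)
    (fun c => ⟨.inr (⟨min (r c) (r (c + 1)), hmin c⟩, c), by simp [zigzagPath]⟩)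
  have hf : Function.Bijective f := by
    constructor
    · rintro (c | c) (d | d) h <;> simp_all [f]
    · rintro ⟨⟨i, c⟩ | ⟨i, c⟩, h⟩
      · exact ⟨.inl c, Subtype.ext (by
          simp only [zigzagPath, hone] at h
          simp [f, ← h])⟩
      · exact ⟨.inr c, Subtype.ext (by
          simp only [zigzagPath, hone] at h
          simp [f, ← h])⟩
  rw [← Nat.card_congr (Equiv.ofBijective f hf), Nat.card_sum, Nat.card_fin, Nat.card_fin]

theorem half_pow_path_length {k : ℕ} (hk : 0 < k) :
    (1 / 2 : ℝ) ^ (k + (k - 1)) = 2 * (1 / 4 : ℝ) ^ k := by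
  obtain ⟨k, rfl⟩ := Nat.exists_eq_add_of_lt hk
  rw [show (1 / 4 : ℝ) = (1 / 2) ^ 2 by norm_num, ← pow_mul,
    show 2 * (0 + k + 1) = 0 + k + 1 + (0 + k + 1 - 1) + 1 by omega, pow_succ _ (_ + _)]
  ring

theorem hasEfficiency_zigzagFormation (hn : 0 < n) (hm : 0 < m) {r : ℕ → ℕ}
    (hr : IsZigzag n m r) :
    HasEfficiency (surfaceCode n m hn hm) (zigzagFormation n m r) (1 - 2 * (1 / 4 : ℝ) ^ n) := by
  have hC := surfaceCode_encodesOneQubit n m hn hm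
  have h := hC.hasEfficiency (zigzagFormation n m r)
  rwa [(zigzagPath_isMinimalPath hn hm hr).unambiguousFraction_eq hC, card_zigzagPath hr,
    half_pow_path_length hn] at h
  rintro (e | e)
  · simp only [zigzagFormation, zigzagPath]
    split_ifs <;> simp_all
  · simp only [zigzagFormation, zigzagPath]
    split_ifs <;> simp_all

/-- The reflected zig-zag is a minimal path of the code with `X` and `Z` exchanged. -/
theorem transpose_zigzagPath_isMinimalPath (hn : 0 < n) (hm : 0 < m) {c : ℕ → ℕ}
    (hc : IsZigzag m n c) :
    (surfaceCode n m hn hm).dual.IsMinimalPath (zigzagPath m n c ∘ transposeEdge n m) := by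
  have hp := zigzagPath_isMinimalPath hm hn hc
  have hsymm : ∀ y : Edge m n → ZMod 2,
      (y ∘ transposeEdge n m) ∘ (transposeEdge n m).symm = y := fun y => by
    ext e; simp
  refine ⟨transpose_mem_checkKernel.1 (by rw [hsymm]; exact hp.mem), ?_, fun x hx hsupp => ?_⟩
  · change firstRow n m ⬝ᵥ _ = 1
    rw [firstRow_eq_firstColumn_transpose, comp_transpose_dotProduct, hsymm]
    exact hp.logX
  · have hx' : x = (x ∘ (transposeEdge n m).symm) ∘ transposeEdge n m := by ext e; simp
    rcases hp.eq_zero_or_eq _ (transpose_mem_checkKernel.2 hx)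
      (fun e he => hsupp _ (by simpa using he)) with h | h
    · left
      rw [hx', h]
      rfl
    · right
      rw [hx', h]

theorem hasEfficiency_dualZigzagFormation (hn : 0 < n) (hm : 0 < m) {c : ℕ → ℕ}
    (hc : IsZigzag m n c) :
    HasEfficiency (surfaceCode n m hn hm) (dualZigzagFormation n m c)
      (1 - 2 * (1 / 4 : ℝ) ^ m) := by
  have hC := surfaceCode_encodesOneQubit n m hn hm
  have h := hC.hasEfficiency (dualZigzagFormation n m c)
  have hcard : Nat.card {e // (zigzagPath m n c ∘ transposeEdge n m) e = 1} = m + (m - 1) := by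
    rw [← card_zigzagPath hc]
    exact Nat.card_congr ((transposeEdge n m).subtypeEquiv fun e => Iff.rfl)
  rwa [← CSSCode.unambiguousFraction_dual,
    (transpose_zigzagPath_isMinimalPath hn hm hc).unambiguousFraction_eq hC.dual, hcard,
    half_pow_path_length hm] at h
  rintro (e | e)
  · simp only [dualZigzagFormation, zigzagPath, transposeEdge, Function.comp_apply,
      Equiv.sumCongr_apply, Sum.map_inl, Equiv.prodComm_apply, Prod.fst_swap, Prod.snd_swap]
    split_ifs <;> simp_all [PhysicalBM.dual]
  · simp only [dualZigzagFormation, zigzagPath, transposeEdge, Function.comp_apply,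
      Equiv.sumCongr_apply, Sum.map_inr, Equiv.prodComm_apply, Prod.fst_swap, Prod.snd_swap]
    split_ifs <;> simp_all [PhysicalBM.dual]

theorem diagonalFormation_eq_zigzagFormation (n : ℕ) :
    diagonalFormation n = zigzagFormation n n id := by
  ext e
  rcases e with e | e <;> simp [diagonalFormation, zigzagFormation]

theorem exists_isZigzag {k l : ℕ} (hl : 1 < l) : ∃ r, IsZigzag k l r :=
  ⟨fun i => i % 2, fun i _ => by dsimp only; omega, fun i _ => by dsimp only; omega⟩

end Surface

end LogicalBM

end

theorem mainTheorem8 :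
    (∀ (n : ℕ) (hn : 0 < n),
      LogicalBM.HasEfficiency (LogicalBM.surfaceCode n n hn hn)
        (LogicalBM.diagonalFormation n) (1 - 2 * (1 / 4 : ℝ) ^ n)) ∧
    (∀ (n m : ℕ) (hm : 1 < m) (hmn : m ≤ n),
      (∃ r, LogicalBM.IsZigzag n m r) ∧
      ∀ r, LogicalBM.IsZigzag n m r →
        LogicalBM.HasEfficiency (LogicalBM.surfaceCode n m (by omega) (by omega))
          (LogicalBM.zigzagFormation n m r) (1 - 2 * (1 / 4 : ℝ) ^ max n m)) ∧
    (∀ (n m : ℕ) (hn : 1 < n) (hnm : n ≤ m),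
      (∃ c, LogicalBM.IsZigzag m n c) ∧
      ∀ c, LogicalBM.IsZigzag m n c →
        LogicalBM.HasEfficiency (LogicalBM.surfaceCode n m (by omega) (by omega))
          (LogicalBM.dualZigzagFormation n m c) (1 - 2 * (1 / 4 : ℝ) ^ max n m)) := by
  refine ⟨fun n hn => ?_, fun n m hm hmn => ⟨LogicalBM.exists_isZigzag hm, fun r hr => ?_⟩,
    fun n m hn hnm => ⟨LogicalBM.exists_isZigzag hn, fun c hc => ?_⟩⟩
  -- the diagonal is the zig-zag that goes down in every step
  · rw [LogicalBM.diagonalFormation_eq_zigzagFormation]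
    exact LogicalBM.hasEfficiency_zigzagFormation hn hn ⟨fun i hi => hi, fun i _ => Or.inl rfl⟩
  · rw [max_eq_left hmn]
    exact LogicalBM.hasEfficiency_zigzagFormation _ _ hr
  · rw [max_eq_right hnm]
    exact LogicalBM.hasEfficiency_dualZigzagFormation _ _ hc
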